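/- Let $k$ be a field and let $(H,\Delta)$ be a Hopf algebra over $k$ with counit $\varepsilon$. Assume that $H$ has invariant functionals, i.e. there are non-zero linear functionals $\varphi,\psi:H\to k$ with $$(\mathrm{id}\otimes\varphi)\Delta(h)=\varphi(h)1,\qquad (\psi\otimes\mathrm{id})\Delta(h)=\psi(h)1\qquad (h\in H).$$ Let $A$ be an associative, not necessarily unital $k$-algebra with a coaction of $H$, i.e. an algebra homomorphism $\alpha:A\to A\otimes H$ with $(\alpha\otimes\mathrm{id})\alpha=(\mathrm{id}\otimes\Delta)\alpha$ and $(\mathrm{id}\otimes\varepsilon)\alpha=\mathrm{id}$, and let $A^\alpha=\{a\in A\mid \alpha(a)=a\otimes 1\}$ be its algebra of coinvariants. Let $I$ be a set, and let $k_I=\bigoplus_{i\in I}k$ be the algebra of finitely supported functions $I\to k$ with pointwise operations. Assume that $(A,\alpha)$ is an $I$-Galois object, i.e. the Galois map $$A\otimes_{A^\alpha}A\to A\otimes H,\qquad a\otimes b\mapsto (a\otimes 1)\alpha(b)$$ is bijective (where $A\otimes_{A^\alpha}A$ is the quotient of $A\otimes A$ by the span of the elements $ac\otimes b-a\otimes cb$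 with $a,b\in A$, $c\in A^\alpha$), and $A^\alpha\cong k_I$ as $k$-algebras. Fix such an isomorphism and write $p_i\in A^\alpha$ for the element corresponding to the indicator function of $\{i\}$. Let $$\Phi:A\to A^\alpha,\quad \Phi(a)=(\mathrm{id}\otimes\varphi)\alpha(a),\qquad \mathscr S:A^\alpha\to k,\quad \mathscr S\Big(\sum_i a_ip_i\Big)=\sum_i a_i,$$ and $\varphi_A=\mathscr S\circ\Phi:A\to k$. Then there exists an automorphism $\sigma_A:A\to A$ of the $k$-algebra $A$ such that $$\varphi_A(xy)=\varphi_A(y\,\sigma_A(x))\qquad\text{for all }x,y\in A.$$ -/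

import Mathlib

open scoped TensorProduct

noncomputable section

namespace GaloisObject

universe u v w x

/-- `φ` is a left invariant functional on `H`: `(id ⊗ φ)Δ(h) = φ(h) 1` for all `h`. -/
def IsLeftInvariant {k : Type u} {H : Type v} [Field k] [Ring H] [HopfAlgebra k H]
    (φ : H →ₗ[k] k) : Prop :=
  ∀ h : H, TensorProduct.rid k H (φ.lTensor H (Coalgebra.comul h)) = φ h • (1 : H)

/-- `ψ` is a right invariant functional on `H`: `(ψ ⊗ id)Δ(h) = ψ(h) 1` for all `h`. -/
def IsRightInvariant {k : Type u} {H : Type v} [Field k] [Ring H] [HopfAlgebra k H]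
    (ψ : H →ₗ[k] k) : Prop :=
  ∀ h : H, TensorProduct.lid k H (ψ.rTensor H (Coalgebra.comul h)) = ψ h • (1 : H)

section Coaction

variable {k : Type u} {H : Type v} {A : Type w} [Field k] [Ring H] [HopfAlgebra k H]
  [NonUnitalRing A] [Module k A] [IsScalarTower k A A] [SMulCommClass k A A]

/-- The algebra homomorphism `α : A → A ⊗ H` makes the (not necessarily unital) algebra `A` into a
right `H`-comodule: `(α ⊗ id)α = (id ⊗ Δ)α` and `(id ⊗ ε)α = id`. -/
structure IsCoaction (α : A →ₙₐ[k] A ⊗[k] H) : Prop where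
  coassoc : ∀ a : A,
    TensorProduct.assoc k A H H ((α : A →ₗ[k] A ⊗[k] H).rTensor H (α a)) =
      (Coalgebra.comul (R := k) (A := H)).lTensor A (α a)
  counit : ∀ a : A,
    TensorProduct.rid k A ((Coalgebra.counit (R := k) (A := H)).lTensor A (α a)) = a

/-- The algebra of coinvariants `A^α = {a | α(a) = a ⊗ 1}`. -/
def coinvariants (α : A →ₙₐ[k] A ⊗[k] H) : NonUnitalSubalgebra k A where
  carrier := {a | α a = a ⊗ₜ[k] (1 : H)}
  add_mem' {a b} ha hb := by
    simp only [Set.mem_ofPred_eq] at *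
    rw [map_add, ha, hb, TensorProduct.add_tmul]
  zero_mem' := by simp
  mul_mem' {a b} ha hb := by
    simp only [Set.mem_ofPred_eq] at *
    rw [map_mul, ha, hb, Algebra.TensorProduct.tmul_mul_tmul, one_mul]
  smul_mem' c a ha := by
    simp only [Set.mem_ofPred_eq] at *
    rw [map_smul, ha, TensorProduct.smul_tmul']

/-- The subspace of `A ⊗ A` spanned by the elements `ab ⊗ c - a ⊗ bc` with `b` coinvariant. -/
def balancingRelations (α : A →ₙₐ[k] A ⊗[k] H) : Submodule k (A ⊗[k] A) :=
  Submodule.span k {t | ∃ (a c : A) (b : coinvariants α),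
    t = (a * (b : A)) ⊗ₜ[k] c - a ⊗ₜ[k] ((b : A) * c)}

/-- The balanced tensor product of `A` with itself over the (possibly non-unital) algebra `A^α`. -/
abbrev BalancedTensor (α : A →ₙₐ[k] A ⊗[k] H) : Type w :=
  (A ⊗[k] A) ⧸ balancingRelations α

/-- The Galois map before passing to the quotient: `a ⊗ b ↦ (a ⊗ 1)α(b)` on `A ⊗ A`. -/
def preGaloisMap (α : A →ₙₐ[k] A ⊗[k] H) : A ⊗[k] A →ₗ[k] A ⊗[k] H :=
  TensorProduct.lift <| LinearMap.mk₂ k (fun a b : A => (a ⊗ₜ[k] (1 : H)) * α b)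
    (fun a a' b => by rw [TensorProduct.add_tmul, add_mul])
    (fun c a b => by rw [← TensorProduct.smul_tmul', smul_mul_assoc])
    (fun a b b' => by rw [map_add, mul_add])
    (fun c a b => by rw [map_smul, mul_smul_comm])

theorem preGaloisMap_tmul (α : A →ₙₐ[k] A ⊗[k] H) (a b : A) :
    preGaloisMap α (a ⊗ₜ[k] b) = (a ⊗ₜ[k] (1 : H)) * α b := rfl

theorem balancingRelations_le_ker (α : A →ₙₐ[k] A ⊗[k] H) :
    balancingRelations α ≤ LinearMap.ker (preGaloisMap α) := by
  refine Submodule.span_le.2 ?_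
  rintro _ ⟨a, c, b, rfl⟩
  have hb : α (b : A) = (b : A) ⊗ₜ[k] (1 : H) := b.2
  simp only [SetLike.mem_coe, LinearMap.mem_ker, map_sub, preGaloisMap_tmul, map_mul, hb]
  rw [← mul_assoc, Algebra.TensorProduct.tmul_mul_tmul, one_mul, sub_self]

/-- The Galois map `A ⊗_{A^α} A → A ⊗ H`, `a ⊗ b ↦ (a ⊗ 1)α(b)`. -/
def galoisMap (α : A →ₙₐ[k] A ⊗[k] H) : BalancedTensor α →ₗ[k] A ⊗[k] H :=
  (balancingRelations α).liftQ (preGaloisMap α) (balancingRelations_le_ker α)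

/-- A Galois coaction: a coaction whose Galois map is an isomorphism. -/
structure IsGaloisCoaction (α : A →ₙₐ[k] A ⊗[k] H) : Prop extends IsCoaction α where
  galois : Function.Bijective (galoisMap α)

/-- The averaging operator `(id ⊗ φ)α`, as a map from `A` to `A`. -/
def averaging (α : A →ₙₐ[k] A ⊗[k] H) (φ : H →ₗ[k] k) : A →ₗ[k] A :=
  (TensorProduct.rid k A).toLinearMap ∘ₗ φ.lTensor A ∘ₗ (α : A →ₗ[k] A ⊗[k] H)

theorem averaging_mem {α : A →ₙₐ[k] A ⊗[k] H} (hα : IsCoaction α) {φ : H →ₗ[k] k}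
    (hφ : IsLeftInvariant φ) (a : A) : averaging α φ a ∈ coinvariants α := by
  change α (averaging α φ a) = averaging α φ a ⊗ₜ[k] (1 : H)
  -- both sides are images of the two sides of coassociativity under `id ⊗ id ⊗ φ`
  have h1 : ∀ t : A ⊗[k] H, α (TensorProduct.rid k A (φ.lTensor A t)) =
      (TensorProduct.rid k H).toLinearMap.lTensor A ((φ.lTensor H).lTensor A
        (TensorProduct.assoc k A H H ((α : A →ₗ[k] A ⊗[k] H).rTensor H t))) := by
    intro t
    induction t with
    | zero => simp
    | add s t hs ht => simp only [map_add, hs, ht]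
    | tmul b h =>
      simp only [LinearMap.lTensor_tmul, TensorProduct.rid_tmul, LinearMap.rTensor_tmul, map_smul]
      change φ h • α b = _
      have : ∀ s : A ⊗[k] H, φ h • s = (TensorProduct.rid k H).toLinearMap.lTensor A
          ((φ.lTensor H).lTensor A (TensorProduct.assoc k A H H (s ⊗ₜ[k] h))) := by
        intro s
        induction s with
        | zero => simp
        | add s t hs ht => simp only [smul_add, TensorProduct.add_tmul, map_add, hs, ht]
        | tmul c g => simp
      exact this (α b)
  have h2 : ∀ t : A ⊗[k] H, (TensorProduct.rid k H).toLinearMap.lTensor A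
      ((φ.lTensor H).lTensor A ((Coalgebra.comul (R := k) (A := H)).lTensor A t)) =
        (TensorProduct.rid k A (φ.lTensor A t)) ⊗ₜ[k] (1 : H) := by
    intro t
    induction t with
    | zero => simp
    | add s t hs ht => simp only [map_add, hs, ht, TensorProduct.add_tmul]
    | tmul b h =>
      simp only [LinearMap.lTensor_tmul, TensorProduct.rid_tmul, LinearEquiv.coe_coe]
      rw [hφ h, TensorProduct.tmul_smul, TensorProduct.smul_tmul']
  exact (h1 (α a)).trans ((congrArg _ (congrArg _ (hα.coassoc a))).trans (h2 (α a)))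

/-- The averaging (Reynolds) operator `Φ : A → A^α`, `Φ(a) = (id ⊗ φ)α(a)`. -/
def reynolds {α : A →ₙₐ[k] A ⊗[k] H} (hα : IsCoaction α) {φ : H →ₗ[k] k}
    (hφ : IsLeftInvariant φ) : A →ₗ[k] coinvariants α :=
  (averaging α φ).codRestrict (coinvariants α).toSubmodule (averaging_mem hα hφ)

/-- The functional `φ_A = 𝒮 ∘ Φ`, where `A^α` is identified through `e` with the algebra `k_I` of
finitely supported functions on `I` and `𝒮` is the sum of the coordinates. -/
def phiA {I : Type x} {α : A →ₙₐ[k] A ⊗[k] H} (hα : IsCoaction α) {φ : H →ₗ[k] k}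
    (hφ : IsLeftInvariant φ) (e : coinvariants α →ₙₐ[k] (I →₀ k)) : A →ₗ[k] k :=
  Finsupp.lsum k (fun _ : I => (LinearMap.id : k →ₗ[k] k)) ∘ₗ
    (e : coinvariants α →ₗ[k] (I →₀ k)) ∘ₗ reynolds hα hφ

end Coaction

end GaloisObject

end

noncomputable section

namespace GaloisObject

open Coalgebra HopfAlgebra WithConv

/-! Let f be a functional that is faithful on both sides, and suppose that every f(x ·) is some f(·
y) and conversely. Then the y attached to x is unique, and x ↦ y is the required automorphism
(`exists_modular_automorphism`). So the task is to prove faithfulness and the exchange of left and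
right translates for φ_A.

For H itself, both properties come from S(a₁)φ(a₂b) = b₁φ(ab₂) and its analogue for ψ. These show
that the functionals φ(y ·) are exactly the ψ(· e), that S is surjective, that ψ is faithful, and
that φ and ψ are translates of each other.

The transfer to A uses surjectivity of a ⊗ b ↦ (a ⊗ 1)α(b) and of a ⊗ b ↦ α(a)(b ⊗ 1); the second
follows from the first because S is surjective. Slicing by φ writes every a as Σ uΦ(v), so finite
sums p of the p_i act as local units. To turn φ_A(bx) into φ_A(yb), write α(x) = Σ a ⊗ g, replace
φ(· g) by φ(c ·), and write p ⊗ c = Σ (u ⊗ 1)α(v). This produces terms uΦ(vb)a. Since Φ(vb) = Σ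
φ_A(p_i v b) p_i, every linear functional of such a term has the form φ_A(yb). -/

/-- The slice map `id ⊗ f`. -/
def sliceRight {k H : Type*} (M : Type*) [CommSemiring k] [AddCommMonoid H] [Module k H]
    [AddCommMonoid M] [Module k M] (f : H →ₗ[k] k) : M ⊗[k] H →ₗ[k] M :=
  (TensorProduct.rid k M).toLinearMap ∘ₗ f.lTensor M

/-- The slice map `f ⊗ id`. -/
def sliceLeft {k H : Type*} (M : Type*) [CommSemiring k] [AddCommMonoid H] [Module k H]
    [AddCommMonoid M] [Module k M] (f : H →ₗ[k] k) : H ⊗[k] M →ₗ[k] M :=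
  (TensorProduct.lid k M).toLinearMap ∘ₗ f.rTensor M

section Slice

variable {k H M : Type*} [CommSemiring k] [AddCommMonoid H] [Module k H]
    [AddCommMonoid M] [Module k M]

@[simp]
theorem sliceRight_tmul (f : H →ₗ[k] k) (m : M) (h : H) :
    sliceRight M f (m ⊗ₜ[k] h) = f h • m := by
  simp [sliceRight]

@[simp]
theorem sliceLeft_tmul (f : H →ₗ[k] k) (m : M) (h : H) :
    sliceLeft M f (h ⊗ₜ[k] m) = f h • m := by
  simp [sliceLeft]

end Slice

/-- A separating family of slices detects zero. -/
theorem eq_zero_of_sliceRight_eq_zero {k H A ι : Type*} [Field k] [AddCommGroup H] [Module k H]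
    [AddCommGroup A] [Module k A] (f : ι → H →ₗ[k] k)
    (hf : ∀ h, (∀ i, f i h = 0) → h = 0) {t : A ⊗[k] H} (ht : ∀ i, sliceRight A (f i) t = 0) :
    t = 0 := by
  let B := Module.Free.chooseBasis k A
  obtain ⟨u, rfl⟩ := TensorProduct.eq_repr_basis_left B t
  refine Finset.sum_eq_zero fun b hb => ?_
  suffices u b = 0 by simp [this]
  refine hf _ fun i => ?_
  have h := ht i
  simp only [Finsupp.sum, map_sum, sliceRight_tmul] at h
  exact linearIndependent_iff'.1 B.linearIndependent _ _ h b hb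

/-! ### Invariant functionals on a Hopf algebra -/

section Hopf

variable {k H : Type*} [Field k] [Ring H] [HopfAlgebra k H] {φ ψ : H →ₗ[k] k}

theorem IsLeftInvariant.sliceRight_comul (hφ : IsLeftInvariant φ) (h : H) :
    sliceRight H φ (comul h) = φ h • (1 : H) := hφ h

theorem IsRightInvariant.sliceLeft_comul (hψ : IsRightInvariant ψ) (h : H) :
    sliceLeft H ψ (comul h) = ψ h • (1 : H) := hψ h

/-- Composing the antipode axiom with f shows that f ∘ S inverts f for convolution; this half and
the next turn the Sweedler identities below into cancellations. -/
theorem algHom_comp_antipode_mul {R : Type*} [Ring R] [Algebra k R] (f : H →ₐ[k] R) :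
    toConv (f.toLinearMap ∘ₗ antipode k) * toConv f.toLinearMap = 1 := by
  have := LinearMap.algHom_comp_convMul_distrib f (toConv (antipode k (A := H)))
    (toConv LinearMap.id)
  rw [LinearMap.antipode_mul_id] at this
  apply WithConv.ofConv_injective
  simp only [LinearMap.comp_id] at this
  rw [← this]
  ext x
  simp [LinearMap.convOne_def]

theorem algHom_mul_comp_antipode {R : Type*} [Ring R] [Algebra k R] (f : H →ₐ[k] R) :
    toConv f.toLinearMap * toConv (f.toLinearMap ∘ₗ antipode k) = 1 := by
  have := LinearMap.algHom_comp_convMul_distrib f (toConv LinearMap.id)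
    (toConv (antipode k (A := H)))
  rw [LinearMap.id_mul_antipode] at this
  apply WithConv.ofConv_injective
  simp only [LinearMap.comp_id] at this
  rw [← this]
  ext x
  simp [LinearMap.convOne_def]

theorem includeLeft_conv_includeRight :
    toConv (Algebra.TensorProduct.includeLeft : H →ₐ[k] H ⊗[k] H).toLinearMap *
      toConv (Algebra.TensorProduct.includeRight : H →ₐ[k] H ⊗[k] H).toLinearMap =
      toConv (Bialgebra.comulAlgHom k H).toLinearMap := by
  ext a
  rw [(ℛ k a).convMul_apply]
  simp [(ℛ k a).eq]

/-- `S(a₁)a₂ ⊗ a₃ = 1 ⊗ a`. -/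
theorem sum_antipode_tmul_one_mul_comul {ι : Type*} {a : H} (r : Repr k a ι) :
    ∑ i ∈ r.index, (antipode k (r.left i) ⊗ₜ[k] (1 : H)) * comul (r.right i) =
      1 ⊗ₜ[k] a := by
  have h := congrArg (toConv ((Algebra.TensorProduct.includeLeft : H →ₐ[k] H ⊗[k] H).toLinearMap
    ∘ₗ antipode k) * ·) (includeLeft_conv_includeRight (k := k) (H := H))
  simp only [← mul_assoc, algHom_comp_antipode_mul, one_mul] at h
  have h' := congr($h a)
  rw [r.convMul_apply] at h'
  simpa using h'.symm

/-- `a₁ ⊗ a₂S(a₃) = a ⊗ 1`. -/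
theorem sum_comul_mul_one_tmul_antipode {ι : Type*} {a : H} (r : Repr k a ι) :
    ∑ i ∈ r.index, comul (r.left i) * ((1 : H) ⊗ₜ[k] antipode k (r.right i)) =
      a ⊗ₜ[k] 1 := by
  have h := congrArg (· * toConv ((Algebra.TensorProduct.includeRight :
    H →ₐ[k] H ⊗[k] H).toLinearMap ∘ₗ antipode k)) (includeLeft_conv_includeRight (k := k) (H := H))
  simp only [mul_assoc, algHom_mul_comp_antipode, mul_one] at h
  have h' := congr($h a)
  rw [r.convMul_apply] at h'
  simpa using h'.symm

/-- `Δ(S(a₁))(a₂ ⊗ 1) = 1 ⊗ S(a)`. -/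
theorem sum_comul_antipode_mul_tmul_one {ι : Type*} {a : H} (r : Repr k a ι) :
    ∑ i ∈ r.index, comul (antipode k (r.left i)) * (r.right i ⊗ₜ[k] (1 : H)) =
      1 ⊗ₜ[k] antipode k a := by
  have h : toConv ((Bialgebra.comulAlgHom k H).toLinearMap ∘ₗ antipode k) *
      toConv (Algebra.TensorProduct.includeLeft : H →ₐ[k] H ⊗[k] H).toLinearMap =
      toConv ((Algebra.TensorProduct.includeRight : H →ₐ[k] H ⊗[k] H).toLinearMap ∘ₗ
        antipode k) := by
    -- Both sides are convolution inverses of the right inclusion ι₂: with ι₁ the left one, (Δ ∘ S)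
    -- * ι₁ * ι₂ = (Δ ∘ S) * Δ = 1.
    refine left_inv_eq_right_inv (a := toConv (Algebra.TensorProduct.includeRight :
      H →ₐ[k] H ⊗[k] H).toLinearMap) ?_ (algHom_mul_comp_antipode _)
    rw [mul_assoc, includeLeft_conv_includeRight, algHom_comp_antipode_mul]
  have h' := congr($h a)
  rw [r.convMul_apply] at h'
  simpa using h'

/-- `S(a₁)φ(a₂b) = b₁φ(ab₂)`. -/
theorem IsLeftInvariant.sum_smul_antipode (hφ : IsLeftInvariant φ) {ι κ : Type*} {a b : H}
    (r : Repr k a ι) (s : Repr k b κ) :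
    ∑ i ∈ r.index, φ (r.right i * b) • antipode k (r.left i) =
      ∑ j ∈ s.index, φ (a * s.right j) • s.left j := by
  have key : ∀ (c : H) (t : H ⊗[k] H), sliceRight H φ ((c ⊗ₜ[k] (1 : H)) * t) =
      c * sliceRight H φ t := by
    intro c t
    induction t with
    | zero => simp
    | add x y hx hy => simp only [mul_add, map_add, hx, hy]
    | tmul x y => simp
  -- Multiply S(a₁)a₂ ⊗ a₃ = 1 ⊗ a by Δ(b) and slice: invariance collapses Δ(a₂b) to φ(a₂b)1.
  have h := congrArg (fun t => sliceRight H φ (t * comul b)) (sum_antipode_tmul_one_mul_comul r)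
  simp only [Finset.sum_mul, map_sum, mul_assoc, ← Bialgebra.comul_mul, key,
    hφ.sliceRight_comul] at h
  rw [← s.eq] at h
  simpa [Finset.mul_sum] using h

/-- `ψ(a₁b)a₂ = ψ(ab₁)S(b₂)`. -/
theorem IsRightInvariant.sum_smul_antipode (hψ : IsRightInvariant ψ) {ι κ : Type*} {a b : H}
    (r : Repr k a ι) (s : Repr k b κ) :
    ∑ i ∈ r.index, ψ (r.left i * b) • r.right i =
      ∑ j ∈ s.index, ψ (a * s.left j) • antipode k (s.right j) := by
  have key : ∀ (c : H) (t : H ⊗[k] H), sliceLeft H ψ (t * ((1 : H) ⊗ₜ[k] c)) =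
      sliceLeft H ψ t * c := by
    intro c t
    induction t with
    | zero => simp
    | add x y hx hy => simp only [add_mul, map_add, hx, hy]
    | tmul x y => simp
  have h := congrArg (fun t => sliceLeft H ψ (comul a * t)) (sum_comul_mul_one_tmul_antipode s)
  simp only [Finset.mul_sum, map_sum, ← mul_assoc, ← Bialgebra.comul_mul, key,
    hψ.sliceLeft_comul] at h
  rw [← r.eq] at h
  simpa [Finset.sum_mul] using h.symm

/-- `ψ(x a₁) φ(b S(a₂)) = ψ(S(b₁)a) φ(b₂x)`. -/
theorem sum_mul_eq_sum_mul (hφ : IsLeftInvariant φ) (hψ : IsRightInvariant ψ) {ι κ : Type*}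
    {a b : H} (r : Repr k a ι) (s : Repr k b κ) (x : H) :
    ∑ i ∈ r.index, ψ (x * r.left i) * φ (b * antipode k (r.right i)) =
      ∑ j ∈ s.index, ψ (antipode k (s.left j) * a) * φ (s.right j * x) := by
  -- Both sides equal ψ(x₁a)φ(bx₂).
  have h1 := congrArg (fun t => φ (b * t)) (hψ.sum_smul_antipode (ℛ k x) r)
  have h2 := congrArg (fun t => ψ (t * a)) (hφ.sum_smul_antipode s (ℛ k x))
  simp only [Finset.mul_sum, Finset.sum_mul, map_sum, mul_smul_comm, smul_mul_assoc, map_smul,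
    smul_eq_mul] at h1 h2
  rw [← h1]
  simp only [mul_comm] at h2 ⊢
  exact h2.symm

theorem exists_apply_eq_one {k M : Type*} [Field k] [AddCommGroup M] [Module k M]
    {f : M →ₗ[k] k} (hf : f ≠ 0) : ∃ x, f x = 1 := by
  obtain ⟨x, hx⟩ := DFunLike.ne_iff.1 hf
  exact ⟨(f x)⁻¹ • x, by simpa using inv_mul_cancel₀ hx⟩

/-- Every functional `φ(y ·)` is of the form `ψ(· e)`. -/
theorem exists_apply_mul_eq_right (hφ : IsLeftInvariant φ) (hψ : IsRightInvariant ψ) (hψ0 : ψ ≠ 0)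
    (y : H) : ∃ e, ∀ x, φ (y * x) = ψ (x * e) := by
  obtain ⟨z, hz⟩ := exists_apply_eq_one hψ0
  have key : ∀ (c : H) (t : H ⊗[k] H),
      sliceLeft H (ψ ∘ₗ LinearMap.mulRight k z ∘ₗ antipode k) ((c ⊗ₜ[k] (1 : H)) * t) =
        sliceLeft H (ψ ∘ₗ LinearMap.mulRight k (antipode k c * z) ∘ₗ antipode k) t := by
    intro c t
    induction t with
    | zero => simp
    | add x y hx hy => simp only [mul_add, map_add, hx, hy]
    | tmul x y => simp [antipode_mul_antidistrib, mul_assoc]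
  -- The identity `sum_mul_eq_sum_mul` settles elements ψ(S(b₁)a)b₂. These span H: applying ψ(S(·)z)
  -- to the first leg of S(y₁)y₂ ⊗ y₃ = 1 ⊗ y writes y as a sum of them.
  have h := congrArg (sliceLeft H (ψ ∘ₗ LinearMap.mulRight k z ∘ₗ antipode k))
    (sum_antipode_tmul_one_mul_comul (ℛ k y))
  simp only [map_sum, key] at h
  simp only [sliceLeft_tmul, LinearMap.comp_apply, antipode_one, LinearMap.mulRight_apply, one_mul,
    hz, one_smul] at h
  have term : ∀ a b : H, ∃ e, ∀ x,
      φ (sliceLeft H (ψ ∘ₗ LinearMap.mulRight k a ∘ₗ antipode k) (comul b) * x) = ψ (x * e) := by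
    intro a b
    refine ⟨∑ i ∈ (ℛ k a).index, φ (b * antipode k ((ℛ k a).right i)) • (ℛ k a).left i,
      fun x => ?_⟩
    have := sum_mul_eq_sum_mul hφ hψ (ℛ k a) (ℛ k b) x
    conv_lhs => rw [← (ℛ k b).eq]
    simp only [map_sum, sliceLeft_tmul, LinearMap.comp_apply, LinearMap.mulRight_apply,
      Finset.sum_mul, Finset.mul_sum, smul_mul_assoc, mul_smul_comm, map_smul, smul_eq_mul]
    rw [← this]
    exact Finset.sum_congr rfl fun i _ => mul_comm _ _
  choose E hE using term
  refine ⟨∑ i ∈ (ℛ k y).index, E (antipode k (antipode k ((ℛ k y).left i)) * z)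
    ((ℛ k y).right i), fun x => ?_⟩
  conv_lhs => rw [← h]
  simp only [Finset.sum_mul, Finset.mul_sum, map_sum, hE]

/-- Every functional `ψ(· e)` is of the form `φ(y ·)`. -/
theorem exists_mul_apply_eq_left (hφ : IsLeftInvariant φ) (hψ : IsRightInvariant ψ) (hφ0 : φ ≠ 0)
    (e : H) : ∃ y, ∀ x, φ (y * x) = ψ (x * e) := by
  obtain ⟨w, hw⟩ := exists_apply_eq_one hφ0
  have key : ∀ (c : H) (t : H ⊗[k] H),
      sliceRight H (φ ∘ₗ LinearMap.mulLeft k w ∘ₗ antipode k) (t * ((1 : H) ⊗ₜ[k] c)) =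
        sliceRight H (φ ∘ₗ LinearMap.mulLeft k (w * antipode k c) ∘ₗ antipode k) t := by
    intro c t
    induction t with
    | zero => simp
    | add x y hx hy => simp only [add_mul, map_add, hx, hy]
    | tmul x y => simp [antipode_mul_antidistrib]
  have h := congrArg (sliceRight H (φ ∘ₗ LinearMap.mulLeft k w ∘ₗ antipode k))
    (sum_comul_mul_one_tmul_antipode (ℛ k e))
  simp only [map_sum, key] at h
  simp only [sliceRight_tmul, LinearMap.comp_apply, antipode_one, LinearMap.mulLeft_apply, mul_one,
    hw, one_smul] at h
  have term : ∀ a b : H, ∃ y, ∀ x, φ (y * x) =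
      ψ (x * sliceRight H (φ ∘ₗ LinearMap.mulLeft k b ∘ₗ antipode k) (comul a)) := by
    intro a b
    refine ⟨∑ i ∈ (ℛ k b).index, ψ (antipode k ((ℛ k b).left i) * a) • (ℛ k b).right i,
      fun x => ?_⟩
    have := sum_mul_eq_sum_mul hφ hψ (ℛ k a) (ℛ k b) x
    conv_rhs => rw [← (ℛ k a).eq]
    simp only [map_sum, sliceRight_tmul, LinearMap.comp_apply, LinearMap.mulLeft_apply,
      Finset.sum_mul, Finset.mul_sum, smul_mul_assoc, mul_smul_comm, map_smul, smul_eq_mul]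
    rw [← this]
    exact Finset.sum_congr rfl fun i _ => mul_comm _ _
  choose Y hY using term
  refine ⟨∑ i ∈ (ℛ k e).index, Y ((ℛ k e).left i)
    (w * antipode k (antipode k ((ℛ k e).right i))), fun x => ?_⟩
  conv_rhs => rw [← h]
  simp only [Finset.sum_mul, Finset.mul_sum, map_sum, hY]

/-- The antipode of a Hopf algebra with invariant functionals is surjective. -/
theorem antipode_surjective (hφ : IsLeftInvariant φ) (hψ : IsRightInvariant ψ) (hφ0 : φ ≠ 0)
    (hψ0 : ψ ≠ 0) : Function.Surjective (antipode k : H →ₗ[k] H) := by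
  intro x
  obtain ⟨v, hv⟩ := exists_apply_eq_one hφ0
  have key : ∀ (c : H) (t : H ⊗[k] H),
      sliceLeft H (φ ∘ₗ LinearMap.mulLeft k v) ((c ⊗ₜ[k] (1 : H)) * t) =
        sliceLeft H (φ ∘ₗ LinearMap.mulLeft k (v * c)) t := by
    intro c t
    induction t with
    | zero => simp
    | add x y hx hy => simp only [mul_add, map_add, hx, hy]
    | tmul x y => simp
  -- This gives x = φ(vS(x₁)x₂)x₃, a sum of terms φ(cy₁)y₂. Each equals ψ(y₁e)y₂ = ψ(ye₁)S(e₂),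
  -- which lies in the range of S.
  have h := congrArg (sliceLeft H (φ ∘ₗ LinearMap.mulLeft k v))
    (sum_antipode_tmul_one_mul_comul (ℛ k x))
  simp only [map_sum, key] at h
  simp only [sliceLeft_tmul, LinearMap.comp_apply, LinearMap.mulLeft_apply, mul_one, hv,
    one_smul] at h
  rw [← LinearMap.mem_range, ← h]
  refine Submodule.sum_mem _ fun i _ => ?_
  generalize v * antipode k ((ℛ k x).left i) = c
  generalize (ℛ k x).right i = y
  obtain ⟨e, he⟩ := exists_apply_mul_eq_right hφ hψ hψ0 c
  rw [← (ℛ k y).eq]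
  simp only [map_sum, sliceLeft_tmul, LinearMap.comp_apply, LinearMap.mulLeft_apply, he]
  rw [hψ.sum_smul_antipode (ℛ k y) (ℛ k e)]
  exact Submodule.sum_mem _ fun j _ => Submodule.smul_mem _ _ ⟨_, rfl⟩

/-- A right invariant functional is left faithful. -/
theorem IsRightInvariant.eq_zero_of_mul_apply (hψ : IsRightInvariant ψ) (hψ0 : ψ ≠ 0) {c : H}
    (hc : ∀ x, ψ (c * x) = 0) : c = 0 := by
  obtain ⟨z, hz⟩ := exists_apply_eq_one hψ0
  -- The left kernel N of ψ satisfies Δ(N) ⊆ N ⊗ H: expand the second leg in a basis and use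
  -- ψ(c₁x)c₂ = ψ(cx₁)S(x₂) = 0.
  have hrepr : ∀ c : H, (∀ x, ψ (c * x) = 0) → ∃ r : Repr k c (Module.Free.ChooseBasisIndex k H),
      ∀ i ∈ r.index, ∀ x, ψ (r.left i * x) = 0 := by
    intro c hc
    let B := Module.Free.chooseBasis k H
    obtain ⟨u, hu⟩ := TensorProduct.eq_repr_basis_right B (comul (R := k) c)
    refine ⟨⟨u.support, fun i => u i, fun i => B i, hu⟩, fun i hi x => ?_⟩
    have h := hψ.sum_smul_antipode ⟨u.support, fun i => u i, fun i => B i, hu⟩ (ℛ k x)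
    simp only [hc, zero_smul, Finset.sum_const_zero] at h
    exact linearIndependent_iff'.1 B.linearIndependent _ _ h i hi
  -- The counit kills N, since ε(c) = ψ(c₁S(c₂)z) with every c₁ in N. Then c = ε(c₁)c₂ = 0.
  have hε : ∀ c : H, (∀ x, ψ (c * x) = 0) → counit (R := k) c = 0 := by
    intro c hc
    obtain ⟨r, hr⟩ := hrepr c hc
    have h := congrArg (fun t => ψ (t * z)) (sum_mul_antipode_eq_smul r)
    simp only [Finset.sum_mul, map_sum, mul_assoc, smul_mul_assoc, one_mul, map_smul, hz,
      smul_eq_mul, mul_one] at h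
    rw [← h]
    exact Finset.sum_eq_zero fun i hi => hr i hi _
  obtain ⟨r, hr⟩ := hrepr c hc
  rw [← sum_counit_smul r]
  exact Finset.sum_eq_zero fun i hi => by rw [hε _ (hr i hi), zero_smul]

/-- A left invariant functional is right faithful. -/
theorem IsLeftInvariant.eq_zero_of_apply_mul (hφ : IsLeftInvariant φ) (hψ : IsRightInvariant ψ)
    (hφ0 : φ ≠ 0) (hψ0 : ψ ≠ 0) {c : H} (hc : ∀ x, φ (x * c) = 0) : c = 0 := by
  refine hψ.eq_zero_of_mul_apply hψ0 fun e => ?_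
  obtain ⟨y, hy⟩ := exists_mul_apply_eq_left hφ hψ hφ0 e
  rw [← hy, hc]

/-- `ψ(a)φ(S(b)) = φ(a S(b₁)) ψ(b₂)`. -/
theorem apply_mul_apply_antipode (hφ : IsLeftInvariant φ) (hψ : IsRightInvariant ψ) {ι : Type*}
    (a : H) {b : H} (r : Repr k b ι) :
    ψ a * φ (antipode k b) =
      ∑ i ∈ r.index, φ (a * antipode k (r.left i)) * ψ (r.right i) := by
  have key : ∀ (c : H) (t : H ⊗[k] H), sliceRight H φ (t * (c ⊗ₜ[k] (1 : H))) =
      sliceRight H φ t * c := by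
    intro c t
    induction t with
    | zero => simp
    | add x y hx hy => simp only [add_mul, map_add, hx, hy]
    | tmul x y => simp
  -- Both sides equal ψ(a₁)φ(a₂S(b)), by invariance of ψ on one side and of φ on the other.
  have h := congrArg (fun t => sliceRight H φ (comul a * t)) (sum_comul_antipode_mul_tmul_one r)
  simp only [Finset.mul_sum, map_sum, ← mul_assoc, ← Bialgebra.comul_mul, key,
    hφ.sliceRight_comul, smul_mul_assoc, one_mul] at h
  have h2 := congrArg (fun t => φ (t * antipode k b)) (hψ.sliceLeft_comul a)
  have h3 := congrArg ψ h
  rw [← (ℛ k a).eq] at h2 h3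
  simp only [Finset.sum_mul, map_sum, Algebra.TensorProduct.tmul_mul_tmul, mul_one,
    sliceRight_tmul, sliceLeft_tmul, map_smul, smul_mul_assoc, one_mul, smul_eq_mul] at h2 h3
  rw [← h2, h3]
  exact Finset.sum_congr rfl fun i _ => mul_comm _ _

/-- Surjectivity of S provides b with φ(S(b)) = 1; then `apply_mul_apply_antipode` reads ψ(x) =
φ(xS(b₁))ψ(b₂). -/
theorem exists_right_invariant_eq (hφ : IsLeftInvariant φ) (hψ : IsRightInvariant ψ) (hφ0 : φ ≠ 0)
    (hψ0 : ψ ≠ 0) : ∃ s, ∀ x, ψ x = φ (x * s) := by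
  obtain ⟨z, hz⟩ := exists_apply_eq_one hφ0
  obtain ⟨b, rfl⟩ := antipode_surjective hφ hψ hφ0 hψ0 z
  refine ⟨∑ i ∈ (ℛ k b).index, ψ ((ℛ k b).right i) • antipode k ((ℛ k b).left i), fun x => ?_⟩
  have h := apply_mul_apply_antipode hφ hψ x (ℛ k b)
  rw [hz, mul_one] at h
  simp only [h, Finset.mul_sum, map_sum, mul_smul_comm, map_smul, smul_eq_mul]
  exact Finset.sum_congr rfl fun i _ => mul_comm _ _

/-- If ψ(z) = 1, then φ(x) = ψ(x₁z)φ(x₂) = ψ(xz₁)φ(S(z₂)). -/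
theorem exists_left_invariant_eq (hφ : IsLeftInvariant φ) (hψ : IsRightInvariant ψ)
    (hψ0 : ψ ≠ 0) : ∃ s, ∀ x, φ x = ψ (x * s) := by
  obtain ⟨z, hz⟩ := exists_apply_eq_one hψ0
  refine ⟨∑ i ∈ (ℛ k z).index, φ (antipode k ((ℛ k z).right i)) • (ℛ k z).left i, fun x => ?_⟩
  have h := congrArg φ (hψ.sum_smul_antipode (ℛ k x) (ℛ k z))
  have h2 := congrArg (fun t => ψ (t * z)) (hφ.sliceRight_comul x)
  rw [← (ℛ k x).eq] at h2
  simp only [Finset.mul_sum, Finset.sum_mul, map_sum, sliceRight_tmul, smul_mul_assoc, one_mul,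
    mul_smul_comm, map_smul, smul_eq_mul, hz, mul_one] at h h2 ⊢
  rw [← h2]
  simp only [mul_comm] at h ⊢
  exact h

/-- A left invariant functional is left faithful. -/
theorem IsLeftInvariant.eq_zero_of_mul_apply (hφ : IsLeftInvariant φ) (hψ : IsRightInvariant ψ)
    (hφ0 : φ ≠ 0) (hψ0 : ψ ≠ 0) {c : H} (hc : ∀ x, φ (c * x) = 0) : c = 0 := by
  obtain ⟨s, hs⟩ := exists_right_invariant_eq hφ hψ hφ0 hψ0
  exact hψ.eq_zero_of_mul_apply hψ0 fun x => by rw [hs, mul_assoc, hc]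

/-- Pass through ψ: φ(c ·) = ψ(· e) = φ(· es). -/
theorem IsLeftInvariant.exists_mul_right_eq (hφ : IsLeftInvariant φ) (hψ : IsRightInvariant ψ)
    (hφ0 : φ ≠ 0) (hψ0 : ψ ≠ 0) (c : H) : ∃ d, ∀ x, φ (c * x) = φ (x * d) := by
  obtain ⟨s, hs⟩ := exists_right_invariant_eq hφ hψ hφ0 hψ0
  obtain ⟨e, he⟩ := exists_apply_mul_eq_right hφ hψ hψ0 c
  exact ⟨e * s, fun x => by rw [he, hs, mul_assoc]⟩

theorem IsLeftInvariant.exists_mul_left_eq (hφ : IsLeftInvariant φ) (hψ : IsRightInvariant ψ)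
    (hφ0 : φ ≠ 0) (hψ0 : ψ ≠ 0) (d : H) : ∃ c, ∀ x, φ (c * x) = φ (x * d) := by
  obtain ⟨s, hs⟩ := exists_left_invariant_eq hφ hψ hψ0
  obtain ⟨y, hy⟩ := exists_mul_apply_eq_left hφ hψ hφ0 (d * s)
  exact ⟨y, fun x => by rw [hy, hs, mul_assoc]⟩

end Hopf

/-! ### The two Galois maps and slices of the coaction -/

section Coaction

variable {k H A : Type*} [Field k] [Ring H] [HopfAlgebra k H]
  [NonUnitalRing A] [Module k A] [IsScalarTower k A A] [SMulCommClass k A A]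
  {α : A →ₙₐ[k] A ⊗[k] H} {φ ψ : H →ₗ[k] k}

/-- The map `a ⊗ b ↦ α(a)(b ⊗ 1)`. -/
def rightGaloisMap (α : A →ₙₐ[k] A ⊗[k] H) : A ⊗[k] A →ₗ[k] A ⊗[k] H :=
  TensorProduct.lift <| LinearMap.mk₂ k (fun a b : A => α a * (b ⊗ₜ[k] (1 : H)))
    (fun a a' b => by rw [map_add, add_mul])
    (fun c a b => by rw [map_smul, smul_mul_assoc])
    (fun a b b' => by rw [TensorProduct.add_tmul, mul_add])
    (fun c a b => by rw [← TensorProduct.smul_tmul', mul_smul_comm])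

theorem rightGaloisMap_tmul (α : A →ₙₐ[k] A ⊗[k] H) (a b : A) :
    rightGaloisMap α (a ⊗ₜ[k] b) = α a * (b ⊗ₜ[k] (1 : H)) := rfl

/-- The map `a ⊗ h ↦ α(a)(1 ⊗ S(h))`. -/
def antipodeTwist (α : A →ₙₐ[k] A ⊗[k] H) : A ⊗[k] H →ₗ[k] A ⊗[k] H :=
  (LinearMap.mul' k H ∘ₗ (antipode k).lTensor H).lTensor A ∘ₗ
    (TensorProduct.assoc k A H H).toLinearMap ∘ₗ (α : A →ₗ[k] A ⊗[k] H).rTensor H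

theorem antipodeTwist_tmul (α : A →ₙₐ[k] A ⊗[k] H) (a : A) (h : H) :
    antipodeTwist α (a ⊗ₜ[k] h) = (LinearMap.mulRight k (antipode k h)).lTensor A (α a) := by
  have key : ∀ t : A ⊗[k] H, (LinearMap.mul' k H ∘ₗ (antipode k).lTensor H).lTensor A
      (TensorProduct.assoc k A H H (t ⊗ₜ[k] h)) =
        (LinearMap.mulRight k (antipode k h)).lTensor A t := by
    intro t
    induction t with
    | zero => simp
    | add x y hx hy => simp only [TensorProduct.add_tmul, map_add, hx, hy]
    | tmul x y => simp
  exact key (α a)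

theorem lTensor_mulRight_mul (c : H) (s t : A ⊗[k] H) :
    (LinearMap.mulRight k c).lTensor A (s * t) = s * (LinearMap.mulRight k c).lTensor A t := by
  induction t with
  | zero => simp
  | add x y hx hy => simp only [mul_add, map_add, hx, hy]
  | tmul x y =>
    induction s with
    | zero => simp
    | add x y hx hy => simp only [add_mul, map_add, hx, hy]
    | tmul u v => simp [mul_assoc]

theorem antipodeTwist_tmul_one_mul (α : A →ₙₐ[k] A ⊗[k] H) (a : A) (t : A ⊗[k] H) :
    antipodeTwist α ((a ⊗ₜ[k] (1 : H)) * t) = α a * antipodeTwist α t := by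
  induction t with
  | zero => simp
  | add x y hx hy => simp only [mul_add, map_add, hx, hy]
  | tmul b h =>
    rw [Algebra.TensorProduct.tmul_mul_tmul, one_mul, antipodeTwist_tmul, antipodeTwist_tmul,
      map_mul, lTensor_mulRight_mul]

theorem IsCoaction.lTensor_counit (hα : IsCoaction α) (a : A) :
    (Coalgebra.counit (R := k) (A := H)).lTensor A (α a) = a ⊗ₜ[k] 1 := by
  rw [← (TensorProduct.rid k A).injective.eq_iff, hα.counit]
  simp

theorem IsCoaction.injective (hα : IsCoaction α) : Function.Injective α := by
  intro a b h
  rw [← hα.counit a, h, hα.counit]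

/-- In Sweedler form, a₀ ⊗ ga₁ ↦ a₀ ⊗ a₁S(a₂)S(g) = a ⊗ S(g). Thus surjectivity of S passes to the
twist. -/
theorem IsCoaction.antipodeTwist_lTensor_mulLeft (hα : IsCoaction α) (a : A) (g : H) :
    antipodeTwist α ((LinearMap.mulLeft k g).lTensor A (α a)) = a ⊗ₜ[k] antipode k g := by
  have h1 : ∀ t : A ⊗[k] H, antipodeTwist α ((LinearMap.mulLeft k g).lTensor A t) =
      (LinearMap.mulRight k (antipode k g) ∘ₗ LinearMap.mul' k H ∘ₗ
        (antipode k).lTensor H).lTensor A (TensorProduct.assoc k A H H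
          ((α : A →ₗ[k] A ⊗[k] H).rTensor H t)) := by
    intro t
    induction t with
    | zero => simp
    | add x y hx hy => simp only [map_add, hx, hy]
    | tmul b h =>
      rw [LinearMap.lTensor_tmul, antipodeTwist_tmul, LinearMap.rTensor_tmul]
      change _ = LinearMap.lTensor A _ (TensorProduct.assoc k A H H (α b ⊗ₜ[k] h))
      generalize α b = s
      induction s with
      | zero => simp
      | add x y hx hy => simp only [TensorProduct.add_tmul, map_add, hx, hy]
      | tmul x y => simp [antipode_mul_antidistrib, mul_assoc]
  rw [h1, hα.coassoc]
  have h2 : (LinearMap.mulRight k (antipode k g) ∘ₗ LinearMap.mul' k H ∘ₗ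
      (antipode k).lTensor H) ∘ₗ comul =
        LinearMap.toSpanSingleton k H (antipode k g) ∘ₗ (Coalgebra.counit (R := k) (A := H)) := by
    ext h
    simp [Algebra.algebraMap_eq_smul_one]
  rw [← LinearMap.comp_apply, ← LinearMap.lTensor_comp, h2, LinearMap.lTensor_comp,
    LinearMap.comp_apply, hα.lTensor_counit]
  simp

theorem IsCoaction.antipodeTwist_apply (hα : IsCoaction α) (a : A) :
    antipodeTwist α (α a) = a ⊗ₜ[k] 1 := by
  have h := hα.antipodeTwist_lTensor_mulLeft a 1
  rwa [antipode_one, LinearMap.mulLeft_one, LinearMap.lTensor_id] at h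

/-- The twist sends (u ⊗ 1)α(v) to α(u) times the twist of α(v), which is v ⊗ 1. -/
theorem IsCoaction.antipodeTwist_preGaloisMap (hα : IsCoaction α) (s : A ⊗[k] A) :
    antipodeTwist α (preGaloisMap α s) = rightGaloisMap α s := by
  induction s with
  | zero => simp
  | add x y hx hy => simp only [map_add, hx, hy]
  | tmul u v =>
    rw [preGaloisMap_tmul, rightGaloisMap_tmul, antipodeTwist_tmul_one_mul, hα.antipodeTwist_apply]

theorem IsCoaction.antipodeTwist_surjective (hα : IsCoaction α)
    (hS : Function.Surjective (antipode k : H →ₗ[k] H)) :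
    Function.Surjective (antipodeTwist α) := by
  intro t
  rw [← LinearMap.mem_range]
  induction t with
  | zero => exact zero_mem _
  | add x y hx hy => exact add_mem hx hy
  | tmul a h =>
    obtain ⟨g, rfl⟩ := hS h
    exact ⟨_, hα.antipodeTwist_lTensor_mulLeft a g⟩

theorem IsGaloisCoaction.preGaloisMap_surjective (hα : IsGaloisCoaction α) :
    Function.Surjective (preGaloisMap α) := by
  intro t
  obtain ⟨s, rfl⟩ := hα.galois.2 t
  obtain ⟨s, rfl⟩ := Submodule.mkQ_surjective _ s
  exact ⟨s, rfl⟩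

theorem IsGaloisCoaction.rightGaloisMap_surjective (hα : IsGaloisCoaction α)
    (hS : Function.Surjective (antipode k : H →ₗ[k] H)) :
    Function.Surjective (rightGaloisMap α) := by
  intro t
  obtain ⟨t, rfl⟩ := hα.toIsCoaction.antipodeTwist_surjective hS t
  obtain ⟨s, rfl⟩ := hα.preGaloisMap_surjective t
  exact ⟨s, (hα.toIsCoaction.antipodeTwist_preGaloisMap s).symm⟩

theorem averaging_apply (α : A →ₙₐ[k] A ⊗[k] H) (φ : H →ₗ[k] k) (a : A) :
    averaging α φ a = sliceRight A φ (α a) := rfl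

theorem sliceRight_tmul_mul (φ : H →ₗ[k] k) (a : A) (c : H) (t : A ⊗[k] H) :
    sliceRight A φ ((a ⊗ₜ[k] c) * t) = a * sliceRight A (φ ∘ₗ LinearMap.mulLeft k c) t := by
  induction t with
  | zero => simp
  | add x y hx hy => simp only [mul_add, map_add, hx, hy]
  | tmul x y => simp [mul_smul_comm]

theorem sliceRight_mul_tmul (φ : H →ₗ[k] k) (a : A) (c : H) (t : A ⊗[k] H) :
    sliceRight A φ (t * (a ⊗ₜ[k] c)) = sliceRight A (φ ∘ₗ LinearMap.mulRight k c) t * a := by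
  induction t with
  | zero => simp
  | add x y hx hy => simp only [add_mul, map_add, hx, hy]
  | tmul x y => simp [smul_mul_assoc]

theorem averaging_coinvariant_mul {c : A} (hc : α c = c ⊗ₜ[k] 1) (a : A) :
    averaging α φ (c * a) = c * averaging α φ a := by
  rw [averaging_apply, map_mul, hc, sliceRight_tmul_mul, LinearMap.mulLeft_one, LinearMap.comp_id,
    averaging_apply]

theorem averaging_mul_coinvariant {c : A} (hc : α c = c ⊗ₜ[k] 1) (a : A) :
    averaging α φ (a * c) = averaging α φ a * c := by
  rw [averaging_apply, map_mul, hc, sliceRight_mul_tmul, LinearMap.mulRight_one, LinearMap.comp_id,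
    averaging_apply]

/-- The map `a ⊗ b ↦ a Φ(b c)`. -/
def mulAveraging (α : A →ₙₐ[k] A ⊗[k] H) (φ : H →ₗ[k] k) (c : A) : A ⊗[k] A →ₗ[k] A :=
  LinearMap.mul' k A ∘ₗ (averaging α φ ∘ₗ LinearMap.mulRight k c).lTensor A

/-- The map `a ⊗ b ↦ Φ(c a) b`. -/
def averagingMul (α : A →ₙₐ[k] A ⊗[k] H) (φ : H →ₗ[k] k) (c : A) : A ⊗[k] A →ₗ[k] A :=
  LinearMap.mul' k A ∘ₗ (averaging α φ ∘ₗ LinearMap.mulLeft k c).rTensor A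

theorem sliceRight_preGaloisMap_mul (φ : H →ₗ[k] k) (c : A) (s : A ⊗[k] A) :
    sliceRight A φ (preGaloisMap α s * α c) = mulAveraging α φ c s := by
  induction s with
  | zero => simp
  | add x y hx hy => simp only [map_add, add_mul, hx, hy]
  | tmul u v =>
    rw [preGaloisMap_tmul, mul_assoc, ← map_mul, sliceRight_tmul_mul, LinearMap.mulLeft_one,
      LinearMap.comp_id]
    rfl

theorem sliceRight_mul_rightGaloisMap (φ : H →ₗ[k] k) (c : A) (s : A ⊗[k] A) :
    sliceRight A φ (α c * rightGaloisMap α s) = averagingMul α φ c s := by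
  induction s with
  | zero => simp
  | add x y hx hy => simp only [map_add, mul_add, hx, hy]
  | tmul u v =>
    rw [rightGaloisMap_tmul, ← mul_assoc, ← map_mul, sliceRight_mul_tmul, LinearMap.mulRight_one,
      LinearMap.comp_id]
    rfl

end Coaction

/-! ### Finitely supported functions and their coordinate sum -/

section SumCoeffs

variable {k I : Type*} [Field k]

/-- The sum of the coordinates of a finitely supported function. -/
abbrev sumCoeffs (k I : Type*) [Field k] : (I →₀ k) →ₗ[k] k :=
  Finsupp.lsum k (fun _ : I => (LinearMap.id : k →ₗ[k] k))

/-- The indicator function of a finite set. -/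
def indicatorOne (k : Type*) {I : Type*} [Field k] (F : Finset I) : I →₀ k :=
  ∑ i ∈ F, Finsupp.single i 1

theorem mul_single_one (f : I →₀ k) (i : I) : f * Finsupp.single i 1 = Finsupp.single i (f i) := by
  classical
  ext j
  by_cases h : i = j
  · subst h; simp
  · simp [h]

theorem single_one_mul (f : I →₀ k) (i : I) : Finsupp.single i 1 * f = Finsupp.single i (f i) := by
  classical
  ext j
  by_cases h : i = j
  · subst h; simp
  · simp [h]

theorem mul_indicatorOne {f : I →₀ k} {F : Finset I} (h : f.support ⊆ F) :
    f * indicatorOne k F = f := by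
  simp only [indicatorOne, Finset.mul_sum, mul_single_one]
  exact (Finsupp.sum_of_support_subset f h _ (by simp)).symm.trans f.sum_single

theorem finsupp_mul_comm (f g : I →₀ k) : f * g = g * f := by
  ext i
  simp [mul_comm]

theorem indicatorOne_mul {f : I →₀ k} {F : Finset I} (h : f.support ⊆ F) :
    indicatorOne k F * f = f := by
  rw [finsupp_mul_comm, mul_indicatorOne h]

theorem sumCoeffs_mul_single (f : I →₀ k) (i : I) :
    sumCoeffs k I (f * Finsupp.single i 1) = f i := by
  simp [mul_single_one]

theorem sumCoeffs_single_mul (f : I →₀ k) (i : I) :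
    sumCoeffs k I (Finsupp.single i 1 * f) = f i := by
  simp [single_one_mul]

end SumCoeffs

/-! ### Local units, translates and faithfulness for φ_A -/

variable {k H A I : Type*} [Field k] [Ring H] [HopfAlgebra k H]
  [NonUnitalRing A] [Module k A] [IsScalarTower k A A] [SMulCommClass k A A]
  {α : A →ₙₐ[k] A ⊗[k] H} {φ ψ : H →ₗ[k] k}

/-- An embedding `j` of the finitely supported functions on `I` into the coinvariants of `α`,
through which the averaging operator factors as `j ∘ T`. -/
structure IsDiagonalAveraging (α : A →ₙₐ[k] A ⊗[k] H) (φ : H →ₗ[k] k) (j : (I →₀ k) →ₙₐ[k] A)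
    (T : A →ₗ[k] (I →₀ k)) : Prop where
  coinvariant : ∀ f, α (j f) = j f ⊗ₜ[k] 1
  injective : Function.Injective j
  apply_apply : ∀ a, j (T a) = averaging α φ a

namespace IsDiagonalAveraging

variable {j : (I →₀ k) →ₙₐ[k] A} {T : A →ₗ[k] (I →₀ k)}

theorem map_mul_left (h : IsDiagonalAveraging α φ j T) (f : I →₀ k) (a : A) :
    T (j f * a) = f * T a := by
  apply h.injective
  rw [h.apply_apply, averaging_coinvariant_mul (h.coinvariant f), map_mul j, h.apply_apply]

theorem map_mul_right (h : IsDiagonalAveraging α φ j T) (f : I →₀ k) (a : A) :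
    T (a * j f) = T a * f := by
  apply h.injective
  rw [h.apply_apply, averaging_mul_coinvariant (h.coinvariant f), map_mul j, h.apply_apply]

theorem sumCoeffs_map_single_mul (h : IsDiagonalAveraging α φ j T) (i : I) (a : A) :
    sumCoeffs k I (T (j (Finsupp.single i 1) * a)) = T a i := by
  rw [h.map_mul_left, sumCoeffs_single_mul]

theorem sumCoeffs_map_mul_single (h : IsDiagonalAveraging α φ j T) (i : I) (a : A) :
    sumCoeffs k I (T (a * j (Finsupp.single i 1))) = T a i := by
  rw [h.map_mul_right, sumCoeffs_mul_single]

/-- With φ(z) = 1, slicing a ⊗ z = Σ (u ⊗ 1)α(v) gives a = Σ uΦ(v), and each Φ(v) has finite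
support. -/
theorem exists_mul_indicatorOne (h : IsDiagonalAveraging α φ j T) (hφ0 : φ ≠ 0)
    (hG : Function.Surjective (preGaloisMap α)) (a : A) :
    ∃ F : Finset I, a * j (indicatorOne k F) = a := by
  classical
  obtain ⟨z, hz⟩ := exists_apply_eq_one hφ0
  obtain ⟨s, hs⟩ := hG (a ⊗ₜ[k] z)
  -- Allowing every larger F lets the induction take unions at sums.
  have key : ∀ s : A ⊗[k] A, ∃ F₀ : Finset I, ∀ F, F₀ ⊆ F →
      sliceRight A φ (preGaloisMap α s) * j (indicatorOne k F) =
        sliceRight A φ (preGaloisMap α s) := by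
    intro s
    induction s with
    | zero => exact ⟨∅, by simp⟩
    | add x y hx hy =>
      obtain ⟨F₁, h₁⟩ := hx
      obtain ⟨F₂, h₂⟩ := hy
      refine ⟨F₁ ∪ F₂, fun F hF => ?_⟩
      rw [map_add, map_add, add_mul, h₁ F (Finset.union_subset_left hF),
        h₂ F (Finset.union_subset_right hF)]
    | tmul u v =>
      refine ⟨(T v).support, fun F hF => ?_⟩
      rw [preGaloisMap_tmul, sliceRight_tmul_mul, LinearMap.mulLeft_one, LinearMap.comp_id,
        ← averaging_apply, ← h.apply_apply, mul_assoc, ← map_mul, mul_indicatorOne hF]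
  obtain ⟨F, hF⟩ := key s
  refine ⟨F, ?_⟩
  have := hF F subset_rfl
  rwa [hs, sliceRight_tmul, hz, one_smul] at this

theorem exists_indicatorOne_mul (h : IsDiagonalAveraging α φ j T) (hφ0 : φ ≠ 0)
    (hG : Function.Surjective (rightGaloisMap α)) (a : A) :
    ∃ F : Finset I, j (indicatorOne k F) * a = a := by
  classical
  obtain ⟨z, hz⟩ := exists_apply_eq_one hφ0
  obtain ⟨s, hs⟩ := hG (a ⊗ₜ[k] z)
  have key : ∀ s : A ⊗[k] A, ∃ F₀ : Finset I, ∀ F, F₀ ⊆ F →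
      j (indicatorOne k F) * sliceRight A φ (rightGaloisMap α s) =
        sliceRight A φ (rightGaloisMap α s) := by
    intro s
    induction s with
    | zero => exact ⟨∅, by simp⟩
    | add x y hx hy =>
      obtain ⟨F₁, h₁⟩ := hx
      obtain ⟨F₂, h₂⟩ := hy
      refine ⟨F₁ ∪ F₂, fun F hF => ?_⟩
      rw [map_add, map_add, mul_add, h₁ F (Finset.union_subset_left hF),
        h₂ F (Finset.union_subset_right hF)]
    | tmul u v =>
      refine ⟨(T u).support, fun F hF => ?_⟩
      rw [rightGaloisMap_tmul, sliceRight_mul_tmul, LinearMap.mulRight_one, LinearMap.comp_id,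
        ← averaging_apply, ← h.apply_apply, ← mul_assoc, ← map_mul, indicatorOne_mul hF]
  obtain ⟨F, hF⟩ := key s
  refine ⟨F, ?_⟩
  have := hF F subset_rfl
  rwa [hs, sliceRight_tmul, hz, one_smul] at this

/-- The index set depends on u only, not on f, so the witness y built from it below is independent
of b. -/
theorem mul_mul_eq_sum (j : (I →₀ k) →ₙₐ[k] A) {u : A} {F : Finset I}
    (hu : u * j (indicatorOne k F) = u) (f : I →₀ k) (a : A) :
    u * j f * a = ∑ i ∈ F, f i • (u * j (Finsupp.single i 1) * a) := by
  have h1 : indicatorOne k F * f = ∑ i ∈ F, f i • Finsupp.single i (1 : k) := by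
    simp [indicatorOne, Finset.sum_mul, single_one_mul]
  conv_lhs => rw [← hu, mul_assoc u, ← map_mul, h1]
  simp only [map_sum, map_smul, Finset.mul_sum, Finset.sum_mul, mul_smul_comm, smul_mul_assoc]

theorem exists_sumCoeffs_mul_eq (h : IsDiagonalAveraging α φ j T)
    (hunit : ∀ a, ∃ F : Finset I, a * j (indicatorOne k F) = a) (ω : A →ₗ[k] k)
    (s : A ⊗[k] A) (a : A) :
    ∃ y, ∀ b, ω (mulAveraging α φ b s * a) = sumCoeffs k I (T (y * b)) := by
  induction s with
  | zero => exact ⟨0, by simp⟩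
  | add s t hs ht =>
    obtain ⟨y, hy⟩ := hs
    obtain ⟨z, hz⟩ := ht
    exact ⟨y + z, fun b => by rw [map_add, add_mul, map_add, hy, hz, add_mul, map_add, map_add]⟩
  | tmul u v =>
    obtain ⟨F, hF⟩ := hunit u
    refine ⟨∑ i ∈ F, ω (u * j (Finsupp.single i 1) * a) • (j (Finsupp.single i 1) * v),
      fun b => ?_⟩
    have h1 : mulAveraging α φ b (u ⊗ₜ[k] v) = u * j (T (v * b)) := by
      rw [h.apply_apply]; rfl
    rw [h1, mul_mul_eq_sum j hF]
    simp only [Finset.sum_mul, map_sum, map_smul, smul_mul_assoc, mul_assoc _ v b,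
      h.sumCoeffs_map_single_mul, smul_eq_mul]
    exact Finset.sum_congr rfl fun i _ => mul_comm _ _

theorem exists_sumCoeffs_eq_mul (h : IsDiagonalAveraging α φ j T)
    (hunit : ∀ a, ∃ F : Finset I, a * j (indicatorOne k F) = a) (ω : A →ₗ[k] k)
    (s : A ⊗[k] A) (a : A) :
    ∃ y, ∀ b, ω (a * averagingMul α φ b s) = sumCoeffs k I (T (b * y)) := by
  induction s with
  | zero => exact ⟨0, by simp⟩
  | add s t hs ht =>
    obtain ⟨y, hy⟩ := hs
    obtain ⟨z, hz⟩ := ht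
    exact ⟨y + z, fun b => by rw [map_add, mul_add, map_add, hy, hz, mul_add, map_add, map_add]⟩
  | tmul u v =>
    obtain ⟨F, hF⟩ := hunit a
    refine ⟨∑ i ∈ F, ω (a * j (Finsupp.single i 1) * v) • (u * j (Finsupp.single i 1)),
      fun b => ?_⟩
    have h1 : averagingMul α φ b (u ⊗ₜ[k] v) = j (T (b * u)) * v := by
      rw [h.apply_apply]; rfl
    rw [h1, ← mul_assoc, mul_mul_eq_sum j hF]
    simp only [Finset.mul_sum, map_sum, map_smul, mul_smul_comm, ← mul_assoc,
      h.sumCoeffs_map_mul_single, smul_eq_mul]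
    exact Finset.sum_congr rfl fun i _ => mul_comm _ _

/-- Individual slices of α(b)α(x) need not be coinvariant, so 𝒮 is extended to all of A before the
sum is split. -/
theorem exists_linear_extension (h : IsDiagonalAveraging α φ j T) :
    ∃ ω : A →ₗ[k] k, ∀ f, ω (j f) = sumCoeffs k I f := by
  obtain ⟨g, hg⟩ := LinearMap.exists_leftInverse_of_injective (j : (I →₀ k) →ₗ[k] A)
    (LinearMap.ker_eq_bot.2 h.injective)
  exact ⟨sumCoeffs k I ∘ₗ g, fun f => congrArg (sumCoeffs k I) (LinearMap.congr_fun hg f)⟩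

/-- Every functional `φ_A(· x)` is of the form `φ_A(y ·)`. -/
theorem exists_mul_left_eq (h : IsDiagonalAveraging α φ j T)
    (hunit : ∀ a, ∃ F : Finset I, a * j (indicatorOne k F) = a)
    (hG : Function.Surjective (preGaloisMap α))
    (hmod : ∀ d : H, ∃ c, ∀ x, φ (c * x) = φ (x * d)) (x : A) :
    ∃ y, ∀ b, sumCoeffs k I (T (b * x)) = sumCoeffs k I (T (y * b)) := by
  obtain ⟨ω, hω⟩ := h.exists_linear_extension
  obtain ⟨F, hF⟩ := hunit x
  have key : ∀ t : A ⊗[k] H, ∃ y, ∀ b,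
      ω (sliceRight A φ ((j (indicatorOne k F) ⊗ₜ[k] (1 : H)) * α b * t)) =
        sumCoeffs k I (T (y * b)) := by
    intro t
    induction t with
    | zero => exact ⟨0, by simp⟩
    | add s t hs ht =>
      obtain ⟨y, hy⟩ := hs
      obtain ⟨z, hz⟩ := ht
      exact ⟨y + z, fun b => by rw [mul_add, map_add, map_add, hy, hz, add_mul, map_add, map_add]⟩
    | tmul a g =>
      obtain ⟨c, hc⟩ := hmod g
      obtain ⟨s, hs⟩ := hG (j (indicatorOne k F) ⊗ₜ[k] c)
      obtain ⟨y, hy⟩ := h.exists_sumCoeffs_mul_eq hunit ω s a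
      refine ⟨y, fun b => ?_⟩
      have hc' : φ ∘ₗ LinearMap.mulRight k g = φ ∘ₗ LinearMap.mulLeft k c :=
        LinearMap.ext fun x => (hc x).symm
      rw [← hy, ← sliceRight_preGaloisMap_mul, hs, sliceRight_mul_tmul, sliceRight_tmul_mul,
        sliceRight_tmul_mul, hc', LinearMap.mulLeft_one, LinearMap.comp_id]
  obtain ⟨y, hy⟩ := key (α x)
  refine ⟨y, fun b => ?_⟩
  -- The local unit p inserted on the left moves to the right of x because k_I is commutative, and
  -- xp = x.
  rw [← hy, ← h.coinvariant, ← map_mul, ← map_mul, ← averaging_apply, ← h.apply_apply, hω,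
    mul_assoc, h.map_mul_left, finsupp_mul_comm, ← h.map_mul_right, mul_assoc, hF]

/-- Every functional `φ_A(x ·)` is of the form `φ_A(· y)`. -/
theorem exists_mul_right_eq (h : IsDiagonalAveraging α φ j T)
    (hunit : ∀ a, ∃ F : Finset I, a * j (indicatorOne k F) = a)
    (hunit' : ∀ a, ∃ F : Finset I, j (indicatorOne k F) * a = a)
    (hG : Function.Surjective (rightGaloisMap α))
    (hmod : ∀ c : H, ∃ d, ∀ x, φ (c * x) = φ (x * d)) (x : A) :
    ∃ y, ∀ b, sumCoeffs k I (T (x * b)) = sumCoeffs k I (T (b * y)) := by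
  obtain ⟨ω, hω⟩ := h.exists_linear_extension
  obtain ⟨F, hF⟩ := hunit' x
  have key : ∀ t : A ⊗[k] H, ∃ y, ∀ b,
      ω (sliceRight A φ (t * (α b * (j (indicatorOne k F) ⊗ₜ[k] (1 : H))))) =
        sumCoeffs k I (T (b * y)) := by
    intro t
    induction t with
    | zero => exact ⟨0, by simp⟩
    | add s t hs ht =>
      obtain ⟨y, hy⟩ := hs
      obtain ⟨z, hz⟩ := ht
      exact ⟨y + z, fun b => by rw [add_mul, map_add, map_add, hy, hz, mul_add, map_add, map_add]⟩
    | tmul a g =>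
      obtain ⟨d, hd⟩ := hmod g
      obtain ⟨s, hs⟩ := hG (j (indicatorOne k F) ⊗ₜ[k] d)
      obtain ⟨y, hy⟩ := h.exists_sumCoeffs_eq_mul hunit ω s a
      refine ⟨y, fun b => ?_⟩
      have hd' : φ ∘ₗ LinearMap.mulLeft k g = φ ∘ₗ LinearMap.mulRight k d :=
        LinearMap.ext fun x => hd x
      rw [← hy, ← sliceRight_mul_rightGaloisMap, hs, sliceRight_tmul_mul, sliceRight_mul_tmul,
        sliceRight_mul_tmul, hd', LinearMap.mulRight_one, LinearMap.comp_id]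
  obtain ⟨y, hy⟩ := key (α x)
  refine ⟨y, fun b => ?_⟩
  rw [← hy, ← h.coinvariant, ← map_mul, ← map_mul, ← averaging_apply, ← h.apply_apply, hω,
    ← mul_assoc, h.map_mul_right, finsupp_mul_comm, ← h.map_mul_left, ← mul_assoc, hF]

/-- The functional `φ_A` is left faithful. -/
theorem eq_zero_of_mul_apply (h : IsDiagonalAveraging α φ j T) (hα : IsCoaction α)
    (hunit : ∀ a, ∃ F : Finset I, a * j (indicatorOne k F) = a)
    (hG : Function.Surjective (rightGaloisMap α))
    (hfaith : ∀ c : H, (∀ x, φ (c * x) = 0) → c = 0) {y : A}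
    (hy : ∀ b, sumCoeffs k I (T (y * b)) = 0) : y = 0 := by
  have hT : ∀ b, averaging α φ (y * b) = 0 := by
    intro b
    rw [← h.apply_apply]
    have : T (y * b) = 0 := by
      ext i
      rw [← h.sumCoeffs_map_mul_single, mul_assoc, hy, Finsupp.zero_apply]
    rw [this, map_zero]
  obtain ⟨F, hF⟩ := hunit y
  refine hα.injective ?_
  rw [map_zero]
  -- The functionals φ(· g) separate H. Writing p ⊗ g = Σ α(u)(v ⊗ 1) with yp = y, the slice of α(y)
  -- by φ(· g), multiplied by p, is Σ Φ(yu)v = 0.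
  refine eq_zero_of_sliceRight_eq_zero (fun g => φ ∘ₗ LinearMap.mulRight k g) hfaith fun g => ?_
  obtain ⟨s, hs⟩ := hG (j (indicatorOne k F) ⊗ₜ[k] g)
  have h0 : averagingMul α φ y s = 0 := by
    have : averaging α φ ∘ₗ LinearMap.mulLeft k y = 0 := LinearMap.ext hT
    rw [averagingMul, this, LinearMap.rTensor_zero, LinearMap.comp_zero, LinearMap.zero_apply]
  rw [← sliceRight_mul_rightGaloisMap, hs, sliceRight_mul_tmul] at h0
  rw [← hF, map_mul, h.coinvariant, sliceRight_mul_tmul]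
  simpa using h0

/-- The functional `φ_A` is right faithful. -/
theorem eq_zero_of_apply_mul (h : IsDiagonalAveraging α φ j T) (hα : IsCoaction α)
    (hunit : ∀ a, ∃ F : Finset I, j (indicatorOne k F) * a = a)
    (hG : Function.Surjective (preGaloisMap α))
    (hfaith : ∀ c : H, (∀ x, φ (x * c) = 0) → c = 0) {y : A}
    (hy : ∀ b, sumCoeffs k I (T (b * y)) = 0) : y = 0 := by
  have hT : ∀ b, averaging α φ (b * y) = 0 := by
    intro b
    rw [← h.apply_apply]
    have : T (b * y) = 0 := by
      ext i
      rw [← h.sumCoeffs_map_single_mul, ← mul_assoc, hy, Finsupp.zero_apply]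
    rw [this, map_zero]
  obtain ⟨F, hF⟩ := hunit y
  refine hα.injective ?_
  rw [map_zero]
  refine eq_zero_of_sliceRight_eq_zero (fun g => φ ∘ₗ LinearMap.mulLeft k g) hfaith fun g => ?_
  obtain ⟨s, hs⟩ := hG (j (indicatorOne k F) ⊗ₜ[k] g)
  have h0 : mulAveraging α φ y s = 0 := by
    have : averaging α φ ∘ₗ LinearMap.mulRight k y = 0 := LinearMap.ext hT
    rw [mulAveraging, this, LinearMap.lTensor_zero, LinearMap.comp_zero, LinearMap.zero_apply]
  rw [← sliceRight_preGaloisMap_mul, hs, sliceRight_tmul_mul] at h0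
  rw [← hF, map_mul, h.coinvariant, sliceRight_tmul_mul]
  simpa using h0

end IsDiagonalAveraging

/-! ### The modular automorphism -/

/-- A functional which is faithful on both sides, and for which left and right translates
coincide, admits a modular automorphism. -/
theorem exists_modular_automorphism (f : A →ₗ[k] k)
    (hl : ∀ y, (∀ b, f (y * b) = 0) → y = 0) (hr : ∀ y, (∀ b, f (b * y) = 0) → y = 0)
    (hlr : ∀ x, ∃ y, ∀ b, f (x * b) = f (b * y)) (hrl : ∀ x, ∃ y, ∀ b, f (b * x) = f (y * b)) :
    ∃ σ : A →ₙₐ[k] A, Function.Bijective σ ∧ ∀ x y, f (x * y) = f (y * σ x) := by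
  choose σ hσ using hlr
  -- Right faithfulness makes σ(x) unique, so σ respects each operation once both candidates give
  -- the same functional.
  have huniq : ∀ x y, (∀ b, f (b * x) = f (b * y)) → x = y := by
    intro x y hxy
    rw [← sub_eq_zero]
    exact hr _ fun b => by rw [mul_sub, map_sub, hxy, sub_self]
  refine ⟨{ toFun := σ, map_smul' := fun c x => ?_, map_zero' := ?_, map_add' := fun x y => ?_,
            map_mul' := fun x y => ?_ }, ⟨fun x y hxy => ?_, fun x => ?_⟩, hσ⟩
  · refine huniq _ _ fun b => ?_
    rw [← hσ, smul_mul_assoc, map_smul, hσ]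
    simp [mul_smul_comm]
  · exact huniq _ _ fun b => by rw [← hσ, zero_mul, mul_zero]
  · exact huniq _ _ fun b => by rw [← hσ, add_mul, mul_add, map_add, map_add, hσ x, hσ y]
  · refine huniq _ _ fun b => ?_
    rw [← hσ, mul_assoc, hσ x, mul_assoc, hσ y, mul_assoc]
  · rw [← sub_eq_zero]
    refine hl _ fun b => ?_
    have hxy' : σ x = σ y := hxy
    rw [sub_mul, map_sub, hσ x, hσ y, hxy', sub_self]
  · obtain ⟨y, hy⟩ := hrl x
    exact ⟨y, huniq _ _ fun b => ((hy b).trans (hσ y b)).symm⟩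

end GaloisObject

end

theorem mainTheorem11 {k : Type*} {H : Type*} {A : Type*} {I : Type*}
    [Field k] [Ring H] [HopfAlgebra k H]
    [NonUnitalRing A] [Module k A] [IsScalarTower k A A] [SMulCommClass k A A]
    (φ ψ : H →ₗ[k] k)
    (hφ : GaloisObject.IsLeftInvariant φ) (hφ0 : φ ≠ 0)
    (hψ : GaloisObject.IsRightInvariant ψ) (hψ0 : ψ ≠ 0)
    (α : A →ₙₐ[k] A ⊗[k] H) (hα : GaloisObject.IsGaloisCoaction α)
    (e : GaloisObject.coinvariants α →ₙₐ[k] (I →₀ k)) (he : Function.Bijective e) :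
    ∃ σ : A →ₙₐ[k] A, Function.Bijective σ ∧
      ∀ x y : A, GaloisObject.phiA hα.toIsCoaction hφ e (x * y) =
        GaloisObject.phiA hα.toIsCoaction hφ e (y * σ x) := by
  open GaloisObject in
  obtain ⟨g, hgl, hgr⟩ := Function.bijective_iff_has_inverse.1 he
  let e' : (I →₀ k) →ₙₐ[k] coinvariants α := NonUnitalAlgHom.inverse e g hgl hgr
  let j : (I →₀ k) →ₙₐ[k] A := (NonUnitalSubalgebraClass.subtype (coinvariants α)).comp e'
  -- With this T, `phiA` is `sumCoeffs k I ∘ₗ T` by definition.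
  let T : A →ₗ[k] (I →₀ k) := (e : coinvariants α →ₗ[k] (I →₀ k)) ∘ₗ reynolds hα.toIsCoaction hφ
  have h : IsDiagonalAveraging α φ j T :=
    { coinvariant := fun f => (e' f).2
      injective := Subtype.val_injective.comp hgr.injective
      apply_apply := fun a => congrArg Subtype.val (hgl (reynolds hα.toIsCoaction hφ a)) }
  have hS := antipode_surjective hφ hψ hφ0 hψ0
  have hG := hα.preGaloisMap_surjective
  have hG' := hα.rightGaloisMap_surjective hS
  have hunit := h.exists_mul_indicatorOne hφ0 hG
  have hunit' := h.exists_indicatorOne_mul hφ0 hG'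
  exact exists_modular_automorphism (phiA hα.toIsCoaction hφ e)
    (fun y hy => h.eq_zero_of_mul_apply hα.toIsCoaction hunit hG'
      (fun c hc => hφ.eq_zero_of_mul_apply hψ hφ0 hψ0 hc) hy)
    (fun y hy => h.eq_zero_of_apply_mul hα.toIsCoaction hunit' hG
      (fun c hc => hφ.eq_zero_of_apply_mul hψ hφ0 hψ0 hc) hy)
    (h.exists_mul_right_eq hunit hunit' hG' (hφ.exists_mul_right_eq hψ hφ0 hψ0))
    (h.exists_mul_left_eq hunit hG (hφ.exists_mul_left_eq hψ hφ0 hψ0))
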